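/- For elements $x,y$ of a Lie algebra over a field of characteristic zero let $\sum_{n\ge 1}Z_n(x,y)$ be the (homogeneous) Baker--Campbell--Hausdorff (BCH) series, where $Z_n$ is the Lie polynomial of degree $n$ given by Dynkin's formula $$Z_n(x,y)=\frac1n\sum_{k=1}^n\frac{(-1)^{k+1}}{k}\sum_{\substack{(i_1,j_1),\dots,(i_k,j_k)\ne(0,0)\\ i_1+j_1+\cdots+i_k+j_k=n}}\frac{(\operatorname{ad}x)^{i_1}(\operatorname{ad}y)^{j_1}\cdots(\operatorname{ad}x)^{i_k}(\operatorname{ad}y)^{j_k-1}(y)}{i_1!\,j_1!\cdots i_k!\,j_k!}$$ (a summand with $j_k=0$ is understood to end with $(\operatorname{ad}x)^{i_k-1}(x)$). Let $Z(x,y)$ denote its sum, that is, the limit of the partial sums $\sum_{n=1}^N Z_n(x,y)$, wherever the series converges. In the normed algebra $M_2(\mathbb C)$, with the commutator bracket, consider for $\alpha,\beta\in\mathbb C$ $$X(\alpha)=\begin{pmatrix}-\alpha&0\\0&-2\alpha\end{pmatrix},\qquad Y(\beta)=\begin{pmatrix}0&\beta(\beta-2\pi i)\\0&0\end{pmatrix},$$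 and write $Z(\alpha,\beta):=Z(X(\alpha),Y(\beta))$. Below, $\frac{\alpha}{1-e^{-\alpha}}$ is understood to be $1$ at $\alpha=0$. Then: 1. The BCH series of $X(\alpha),Y(\beta)$ converges if and only if $(\alpha,\beta)$ belongs to $$D=\{(\alpha,\beta)\in\mathbb C^2: |\alpha|<2\pi,\ \beta\notin\{0,2\pi i\}\}\cup(\mathbb C\times\{0,2\pi i\}),$$ and its sum is $$Z(\alpha,\beta)=\begin{pmatrix}-\alpha&\frac{\alpha\beta(\beta-2\pi i)}{1-e^{-\alpha}}\\0&-2\alpha\end{pmatrix}\ \text{ if } |\alpha|<2\pi,\ \beta\notin\{0,2\pi i\},\qquad Z(\alpha,\beta)=\begin{pmatrix}-\alpha&0\\0&-2\alpha\end{pmatrix}\ \text{ if } \alpha\in\mathbb C,\ \beta\in\{0,2\pi i\}.$$ 2. The interior of $D$ is $\operatorname{Int}(D)=\{(\alpha,\beta)\in\mathbb C^2:|\alpha|<2\pi\}$, and $(\alpha,\beta)\mapsto Z(\alpha,\beta)$ is analytic on $\operatorname{Int}(D)$. 3. The set $\Omega=\{(\alpha,\beta)\in\mathbb C^2:\alpha\ne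 2k\pi i \text{ for all } k\in\mathbb Z\setminus\{0\}\}$ is open and contains $\operatorname{Int}(D)$; the map $$P(\alpha,\beta)=\begin{pmatrix}-\alpha&\frac{\alpha\beta(\beta-2\pi i)}{1-e^{-\alpha}}\\0&-2\alpha\end{pmatrix}$$ is analytic on $\Omega$ and coincides with $Z(\alpha,\beta)$ on $\operatorname{Int}(D)$. 4. The prolongation $P$ is singular at $(2\pi i,2\pi i)$: it has no limit in $M_2(\mathbb C)$ as $(\alpha,\beta)\to(2\pi i,2\pi i)$ within $\Omega$, and there is no analytic map on an open neighbourhood $U$ of $(2\pi i,2\pi i)$ that coincides with $P$ on $U\cap\Omega$. Nevertheless $(2\pi i,2\pi i)\in D$, and the BCH series of $X(2\pi i),Y(2\pi i)$ converges to $X(2\pi i)$. -/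

import Mathlib

open Filter Topology
open scoped Nat Matrix.Norms.L2Operator

/- Matrices carry the commutator bracket `⁅A, B⁆ = A * B - B * A` (and the operator norm). -/
attribute [local instance] LieRing.ofAssociativeRing

namespace BCH

/-- The right-nested bracket `[a₁, [a₂, [⋯, [aₘ₋₁, aₘ]]]]` of a non-empty word `a₁ a₂ ⋯ aₘ`
(it is just `a₁` when `m = 1`; the value at the empty word is irrelevant). -/
def nestedBracket {L : Type*} [LieRing L] : List L → L
  | [] => 0
  | [a] => a
  | a :: b :: l => ⁅a, nestedBracket (b :: l)⁆

/-- The word `x^{i₁} y^{j₁} x^{i₂} y^{j₂} ⋯ x^{iₖ} y^{jₖ}`, where `p r = (i_r, j_r)`. -/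
def blockWord {L : Type*} (x y : L) {k : ℕ} (p : Fin k → ℕ × ℕ) : List L :=
  (List.ofFn fun r => List.replicate (p r).1 x ++ List.replicate (p r).2 y).flatten

/-- All `k`-tuples of pairs `(i₁, j₁), …, (iₖ, jₖ)`, each different from `(0, 0)`, such that
`i₁ + j₁ + ⋯ + iₖ + jₖ = n`. (The bound `≤ n` on the entries follows from the last condition,
and only serves to make the set visibly finite.) -/
def blockIndices (n k : ℕ) : Finset (Fin k → ℕ × ℕ) :=
  (Fintype.piFinset fun _ : Fin k => Finset.range (n + 1) ×ˢ Finset.range (n + 1)).filter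
    fun p => (∀ r, p r ≠ (0, 0)) ∧ ∑ r, ((p r).1 + (p r).2) = n

/-- The homogeneous Baker-Campbell-Hausdorff term `Zₙ(x, y)` of degree `n ≥ 1` in a Lie algebra
over a field `K`, in Dynkin's presentation:
`(1/n) ∑ₖ ((-1)^{k+1}/k) ∑ (ad x)^{i₁} (ad y)^{j₁} ⋯ (ad x)^{iₖ} (ad y)^{jₖ-1} (y) / ∏ i_r! j_r!`,
where a summand with `jₖ = 0` is understood to end with `(ad x)^{iₖ-1} (x)`. -/
def bchTerm (K : Type*) [Field K] {L : Type*} [LieRing L] [LieAlgebra K L]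
    (n : ℕ) (x y : L) : L :=
  (1 / (n : K)) • ∑ k ∈ Finset.Icc 1 n, ((-1 : K) ^ (k + 1) / (k : K)) •
    ∑ p ∈ blockIndices n k,
      (1 / ∏ r, (((p r).1 ! : K) * ((p r).2 ! : K))) • nestedBracket (blockWord x y p)

/-- The partial sum `Z₁(x, y) + ⋯ + Z_N(x, y)` of the BCH series. -/
def bchPartialSum (K : Type*) [Field K] {L : Type*} [LieRing L] [LieAlgebra K L]
    (x y : L) (N : ℕ) : L :=
  ∑ n ∈ Finset.Icc 1 N, bchTerm K n x y

/-- The BCH series `∑_{n ≥ 1} Zₙ(x, y)` converges to `z`. -/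
def BCHHasSum (K : Type*) [Field K] {L : Type*} [LieRing L] [LieAlgebra K L] [TopologicalSpace L]
    (x y z : L) : Prop :=
  Tendsto (bchPartialSum K x y) atTop (𝓝 z)

/-- The BCH series `∑_{n ≥ 1} Zₙ(x, y)` converges. -/
def BCHConverges (K : Type*) [Field K] {L : Type*} [LieRing L] [LieAlgebra K L]
    [TopologicalSpace L] (x y : L) : Prop :=
  ∃ z, BCHHasSum K x y z

/-- The sum `Z(x, y)` of the BCH series (meaningful only where the series converges). -/
noncomputable def bchSum (K : Type*) [Field K] {L : Type*} [LieRing L] [LieAlgebra K L]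
    [TopologicalSpace L] (x y : L) : L :=
  haveI : Nonempty L := ⟨x⟩
  limUnder atTop (bchPartialSum K x y)

/-- The complex number `2πi`. -/
noncomputable def twoPiI : ℂ := 2 * (Real.pi : ℂ) * Complex.I

/-- `X(α) = diag(-α, -2α)`. -/
def matX (α : ℂ) : Matrix (Fin 2) (Fin 2) ℂ := !![-α, 0; 0, -(2 * α)]

/-- `Y(β) = β (β - 2πi) E₁₂`. -/
noncomputable def matY (β : ℂ) : Matrix (Fin 2) (Fin 2) ℂ := !![0, β * (β - twoPiI); 0, 0]

/-- Todd's function `ψ(α) = α / (1 - e^{-α})`, with `ψ(0) = 1`. -/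
noncomputable def todd (α : ℂ) : ℂ := if α = 0 then 1 else α / (1 - Complex.exp (-α))

/-- The matrix-valued map `P(α, β)`; its entry `αβ(β - 2πi)/(1 - e^{-α})` is understood as
`β(β - 2πi)` at `α = 0`. It is meaningful on `Omega`. -/
noncomputable def matP (q : ℂ × ℂ) : Matrix (Fin 2) (Fin 2) ℂ :=
  !![-q.1, todd q.1 * (q.2 * (q.2 - twoPiI)); 0, -(2 * q.1)]

/-- The map `(α, β) ↦ Z(X(α), Y(β))`. -/
noncomputable def matZ (q : ℂ × ℂ) : Matrix (Fin 2) (Fin 2) ℂ := bchSum ℂ (matX q.1) (matY q.2)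

/-- The set `D`. -/
def setD : Set (ℂ × ℂ) :=
  {q | ‖q.1‖ < 2 * Real.pi ∧ q.2 ∉ ({0, twoPiI} : Set ℂ)} ∪
    Set.univ ×ˢ ({0, twoPiI} : Set ℂ)

/-- The set `Ω` of all `(α, β)` such that `α ≠ 2kπi` for every non-zero integer `k`. -/
def Omega : Set (ℂ × ℂ) := {q | ∀ k : ℤ, k ≠ 0 → q.1 ≠ (k : ℂ) * twoPiI}

end BCH

namespace BCH

open Finset.HasAntidiagonal (antidiagonal)

/-! ### Dynkin's formula, organised by the number of blocks. -/

section Dynkin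

variable {K : Type*} [Field K] {L : Type*} [LieRing L] [LieAlgebra K L]

/-! Write `e` for the matrix unit in position (1,2) and `c = β(β - 2πi)`, so that `X = X(α)`
satisfies `⁅X, e⁆ = α • e` and `Y = c • e`. All brackets stay in the span of `X` and `e`, where `ad
X` scales `e` and `ad Y` kills it. Hence few words survive in Dynkin's formula, and the words with a
given number of blocks have an explicit generating series (`blockSum_eq`).

The alternating sum over the number of blocks is log(1 + u) at u = exp t - 1 in disguise. It gives
the derivative of t ψ(t), where ψ(t) = t/(1 - exp(-t)) = ∑ b_n t^n (`sum_blockSeries`). The factor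
1/(n+1) in Dynkin's formula undoes the derivative, so the term of degree n + 1 is c α^n b_n e, plus
X when n = 0 (`bchTerm_succ`).

Convergence is therefore that of c ∑ b_n α^n. By Euler's formula |b_{2k}| (2π)^{2k} = 2ζ(2k), which
is bounded and at least 2: the series converges for |α| < 2π, while for |α| ≥ 2π, circle included,
its terms do not tend to 0, so only c = 0 saves convergence. At (2πi, 2πi) a zero of c meets a pole
of ψ, and the limit of `matP` depends on the direction of approach. -/

theorem nestedBracket_cons (a : L) {l : List L} (hl : l ≠ []) :
    nestedBracket (a :: l) = ⁅a, nestedBracket l⁆ := by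
  cases l with
  | nil => exact absurd rfl hl
  | cons b l => rfl

variable (K) in
theorem nestedBracket_replicate_append (a : L) {l : List L} (hl : l ≠ []) (i : ℕ) :
    nestedBracket (List.replicate i a ++ l) = ((LieAlgebra.ad K L a) ^ i) (nestedBracket l) := by
  induction i with
  | zero => simp
  | succ i ih =>
    rw [List.replicate_succ, List.cons_append, nestedBracket_cons _ (by simp [hl]), ih, pow_succ']
    simp

variable (K) in
/-- The inner sum of Dynkin's formula: the contribution of the words with `k` blocks. -/
def blockSum (x y : L) (k n : ℕ) : L :=
  ∑ p ∈ blockIndices n k,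
    (1 / ∏ r, (((p r).1 ! : K) * ((p r).2 ! : K))) • nestedBracket (blockWord x y p)

theorem mem_blockIndices {n k : ℕ} {p : Fin k → ℕ × ℕ} :
    p ∈ blockIndices n k ↔ (∀ r, p r ≠ (0, 0)) ∧ ∑ r, ((p r).1 + (p r).2) = n := by
  simp only [blockIndices, Finset.mem_filter, Fintype.mem_piFinset, Finset.mem_product,
    Finset.mem_range, and_iff_right_iff_imp]
  rintro ⟨-, h⟩ r
  have := Finset.single_le_sum (f := fun r => (p r).1 + (p r).2) (fun _ _ => Nat.zero_le _)
    (Finset.mem_univ r)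
  omega

theorem blockWord_succ {L : Type*} (x y : L) {k : ℕ} (p : Fin (k + 1) → ℕ × ℕ) :
    blockWord x y p = List.replicate (p 0).1 x ++
      (List.replicate (p 0).2 y ++ blockWord x y (Fin.tail p)) := by
  simp [blockWord, List.ofFn_succ, Fin.tail]

theorem blockWord_ne_nil {L : Type*} (x y : L) {k n : ℕ} {p : Fin (k + 1) → ℕ × ℕ}
    (hp : p ∈ blockIndices n (k + 1)) : blockWord x y p ≠ [] := by
  rw [blockWord_succ]
  have := (mem_blockIndices.1 hp).1 0
  contrapose! this
  simp at this
  ext <;> simp [this]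

/-- Peel off the leftmost block (i, j), of size m = i + j; the factorials split off with it. The
case m = 0 is the forbidden block (0, 0). At least one block remains, so the rest of the word is
non-empty and the powers of `ad` apply to its bracket. -/
theorem blockSum_succ_succ (x y : L) (k n : ℕ) :
    blockSum K x y (k + 2) n = ∑ ml ∈ antidiagonal n, ∑ ij ∈ antidiagonal ml.1,
      if ml.1 = 0 then 0 else (1 / ((ij.1 ! : K) * (ij.2 ! : K))) •
        ((LieAlgebra.ad K L x) ^ ij.1) (((LieAlgebra.ad K L y) ^ ij.2)
          (blockSum K x y (k + 1) ml.2)) := by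
  have key : ∀ ml ∈ antidiagonal n, ∀ ij ∈ antidiagonal ml.1,
      (if ml.1 = 0 then 0 else (1 / ((ij.1 ! : K) * (ij.2 ! : K))) •
        ((LieAlgebra.ad K L x) ^ ij.1) (((LieAlgebra.ad K L y) ^ ij.2)
          (blockSum K x y (k + 1) ml.2))) =
      ∑ p ∈ if ml.1 = 0 then ∅ else blockIndices ml.2 (k + 1),
        (1 / ((ij.1 ! : K) * (ij.2 ! : K)) * (1 / ∏ r, (((p r).1 ! : K) * ((p r).2 ! : K)))) •
        nestedBracket (List.replicate ij.1 x ++ (List.replicate ij.2 y ++ blockWord x y p)) := by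
    intro ml _ ij _
    split_ifs with h
    · simp
    · rw [blockSum, map_sum, map_sum, Finset.smul_sum]
      refine Finset.sum_congr rfl fun p hp => ?_
      have h1 := blockWord_ne_nil x y hp
      rw [nestedBracket_replicate_append K _ (by simp [h1]), nestedBracket_replicate_append K _ h1,
        map_smul, map_smul, smul_smul]
  rw [Finset.sum_congr rfl fun ml hml => Finset.sum_congr rfl (key ml hml), blockSum]
  simp only [Finset.sum_sigma']
  refine Finset.sum_nbij'
    (fun p => ⟨((p 0).1 + (p 0).2, n - ((p 0).1 + (p 0).2)), ⟨p 0, Fin.tail p⟩⟩)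
    (fun q => Fin.cons q.2.1 q.2.2) ?_ ?_ ?_ ?_ ?_
  · intro p hp
    obtain ⟨h0, hs⟩ := mem_blockIndices.1 hp
    rw [Fin.sum_univ_succ] at hs
    have h00 : (p 0).1 + (p 0).2 ≠ 0 := fun h => h0 0 (by ext <;> simp <;> omega)
    simp only [Finset.mem_sigma, Finset.HasAntidiagonal.mem_antidiagonal, if_neg h00, mem_blockIndices]
    refine ⟨by omega, trivial, fun r => h0 _, ?_⟩
    simp only [Fin.tail]
    omega
  · rintro ⟨⟨m, l⟩, ⟨i, j⟩, p⟩ hq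
    simp only [Finset.mem_sigma, Finset.HasAntidiagonal.mem_antidiagonal] at hq
    obtain ⟨h1, h2, h3⟩ := hq
    split_ifs at h3 with hm
    · simp at h3
    · obtain ⟨h4, h5⟩ := mem_blockIndices.1 h3
      refine mem_blockIndices.2 ⟨fun r => ?_, ?_⟩
      · refine Fin.cases ?_ (fun r => ?_) r
        · simp only [Fin.cons_zero, ne_eq, Prod.mk.injEq]
          omega
        · simpa using h4 r
      · rw [Fin.sum_univ_succ]
        simp only [Fin.cons_zero, Fin.cons_succ, h5]
        omega
  · intro p _
    exact Fin.cons_self_tail p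
  · rintro ⟨⟨m, l⟩, ⟨i, j⟩, p⟩ hq
    simp only [Finset.mem_sigma, Finset.HasAntidiagonal.mem_antidiagonal] at hq
    obtain ⟨h1, h2, h3⟩ := hq
    subst h2
    have : n - (i + j) = l := by omega
    subst this
    simp
  · intro p _
    rw [Fin.prod_univ_succ, blockWord_succ]
    simp only [Fin.tail]
    congr 1
    rw [one_div_mul_one_div]

theorem blockSum_one (x y : L) (n : ℕ) (hn : n ≠ 0) :
    blockSum K x y 1 n = ∑ ij ∈ antidiagonal n, (1 / ((ij.1 ! : K) * (ij.2 ! : K))) •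
      nestedBracket (List.replicate ij.1 x ++ List.replicate ij.2 y) := by
  rw [blockSum]
  refine Finset.sum_nbij' (fun p => p 0) (fun q _ => q) ?_ ?_ ?_ ?_ ?_
  · intro p hp
    simpa using (mem_blockIndices.1 hp).2
  · rintro ⟨i, j⟩ hq
    simp only [Finset.HasAntidiagonal.mem_antidiagonal] at hq
    refine mem_blockIndices.2 ⟨fun r => ?_, by simpa using hq⟩
    simp only [ne_eq, Prod.mk.injEq]
    omega
  · intro p _
    ext r <;> rw [Subsingleton.elim r 0]
  · intro q _
    rfl
  · intro p _
    simp [blockWord]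

end Dynkin


/-! ### Formal power series: the sum over the number of blocks. -/

section Formal

open PowerSeries

variable (K : Type*) [Field K] [CharZero K]

/-- The generating series of the coefficients of the words with `k + 1` blocks. -/
noncomputable def blockSeries : ℕ → PowerSeries K
  | 0 => exp K
  | k + 1 => (exp K - 1) ^ k * (exp K - 1 - X) * exp K

/-- `log (1 + u)` truncated at `u ^ N`, at `u = exp t - 1`, is `t` up to order `N`. -/
theorem X_pow_dvd_logTrunc (N : ℕ) :
    (X : PowerSeries K) ^ (N + 1) ∣
      (∑ k ∈ Finset.range N, C ((-1 : K) ^ k / ((k : K) + 1)) * (exp K - 1) ^ (k + 1)) - X := by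
  set S := ∑ k ∈ Finset.range N, C ((-1 : K) ^ k / ((k : K) + 1)) * (exp K - 1) ^ (k + 1) with hS
  have hu : (X : PowerSeries K) ∣ exp K - 1 := by simp [X_dvd_iff]
  have hd : derivative K S = exp K * ∑ k ∈ Finset.range N, (1 - exp K) ^ k := by
    rw [hS, map_sum, Finset.mul_sum]
    refine Finset.sum_congr rfl fun k _ => ?_
    have hk : (k : K) + 1 ≠ 0 := by exact_mod_cast Nat.succ_ne_zero k
    rw [← smul_eq_C_mul, Derivation.map_smul, Derivation.leibniz_pow, map_sub, derivative_exp,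
      Derivation.map_one_eq_zero, sub_zero, ← neg_sub (exp K) 1, neg_pow (exp K - 1), smul_eq_C_mul,
      div_eq_mul_inv, map_mul, nsmul_eq_mul, smul_eq_mul, Nat.add_sub_cancel, map_pow, map_neg,
      map_one]
    have : C ((k : K) + 1)⁻¹ * ((k + 1 : ℕ) : PowerSeries K) = 1 := by
      rw [← map_natCast (C (R := K)), ← map_mul]
      push_cast
      rw [inv_mul_cancel₀ hk, map_one]
    linear_combination ((-1) ^ k * (exp K - 1) ^ k * exp K) * this
  -- The geometric sum has ratio 1 - exp t, and the factor exp t is one minus this ratio, so it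
  -- telescopes.
  have hd2 : derivative K (S - X) = - (1 - exp K) ^ N := by
    have := geom_sum_mul (1 - exp K) N
    rw [map_sub, hd, derivative_X]
    linear_combination -this
  have hdvd : (X : PowerSeries K) ^ N ∣ derivative K (S - X) := by
    rw [hd2, ← neg_sub (exp K) 1, neg_pow]
    exact ((pow_dvd_pow_of_dvd hu N).mul_left _).neg_right
  -- In characteristic zero the derivative determines every coefficient except the constant one,
  -- which vanishes separately.
  rw [X_pow_dvd_iff] at hdvd ⊢
  intro m hm
  cases m with
  | zero =>
    rw [coeff_zero_eq_constantCoeff_apply]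
    simp [hS]
  | succ m =>
    have := hdvd m (by omega)
    rw [coeff_derivative] at this
    exact (mul_eq_zero.1 this).resolve_right (by exact_mod_cast Nat.succ_ne_zero m)

/-- With u = exp t - 1, multiplying the sum by u² turns it into an expression in the truncated
logarithm Λ of 1 + u. Replacing Λ by t would give exactly u² (tψ)', by differentiating ψ u = t exp
t. The error is exp t (u - t)(Λ - t); the order 2 of u - t pays for the division by u². -/
theorem sum_blockSeries (N : ℕ) :
    (X : PowerSeries K) ^ (N + 2) ∣
      (∑ k ∈ Finset.range (N + 1), C ((-1 : K) ^ k / ((k : K) + 1)) * blockSeries K k) -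
        derivative K (X * bernoulli'PowerSeries K) := by
  set ψ := bernoulli'PowerSeries K
  set e := exp K with he
  set S := ∑ k ∈ Finset.range (N + 1), C ((-1 : K) ^ k / ((k : K) + 1)) * blockSeries K k with hS
  set Λ := ∑ k ∈ Finset.range (N + 1), C ((-1 : K) ^ k / ((k : K) + 1)) * (e - 1) ^ (k + 1) with hΛ
  have h1 : (e - 1) ^ 2 * S = (e - 1 - X) * e * Λ + (e - 1) * X * e := by
    rw [hS, hΛ, Finset.sum_range_succ', Finset.sum_range_succ', mul_add, mul_add, Finset.mul_sum,
      Finset.mul_sum]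
    have : ∀ k ∈ Finset.range N, (e - 1) ^ 2 * (C ((-1 : K) ^ (k + 1) / (((k + 1 : ℕ) : K) + 1)) *
        blockSeries K (k + 1)) = (e - 1 - X) * e * (C ((-1 : K) ^ (k + 1) / (((k + 1 : ℕ) : K) + 1)) *
          (e - 1) ^ (k + 1 + 1)) := by
      intro k _
      rw [blockSeries, ← he]
      ring
    rw [Finset.sum_congr rfl this]
    simp [blockSeries, ← he]
    ring
  have h2 : ψ * (e - 1) = X * e := bernoulli'PowerSeries_mul_exp_sub_one K
  have h3 : (e - 1) ^ 2 * derivative K (X * ψ) = X * e * (2 * (e - 1) - X) := by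
    have := congrArg (derivative K) h2
    simp only [Derivation.leibniz, map_sub, he, derivative_exp, Derivation.map_one_eq_zero,
      derivative_X, smul_eq_mul] at this ⊢
    rw [← he] at this ⊢
    linear_combination (X * (e - 1)) * this + (e - 1 - X * e) * h2
  have h4 : (e - 1) ^ 2 * (S - derivative K (X * ψ)) = e * ((e - 1 - X) * (Λ - X)) := by
    rw [mul_sub, h1, h3]
    ring
  obtain ⟨A, hA⟩ : (X : PowerSeries K) ^ 2 ∣ e - 1 - X := by
    rw [X_pow_dvd_iff]
    intro m hm
    interval_cases m
    · simp [he]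
    · simp [he, coeff_one]
  obtain ⟨B, hB⟩ := X_pow_dvd_logTrunc K (N + 1)
  have h5 : e - 1 = X * (1 + X * A) := by linear_combination hA
  have hunit : IsUnit ((1 + X * A) ^ 2) := by
    refine IsUnit.pow _ ?_
    rw [isUnit_iff_constantCoeff]
    simp
  rw [← he, ← hΛ] at hB
  rw [← hunit.dvd_mul_left]
  refine ⟨e * A * B, ?_⟩
  rw [hA, hB, h5] at h4
  have hX : (X : PowerSeries K) ^ 2 ≠ 0 := pow_ne_zero _ X_ne_zero
  refine mul_left_cancel₀ hX ?_
  linear_combination h4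

theorem sum_coeff_blockSeries (n : ℕ) :
    ∑ k ∈ Finset.range (n + 1), (-1 : K) ^ k / ((k : K) + 1) * coeff n (blockSeries K k) =
      ((n : K) + 1) * coeff n (bernoulli'PowerSeries K) := by
  have := X_pow_dvd_iff.1 (sum_blockSeries K n) n (by omega)
  rw [map_sub, sub_eq_zero, coeff_derivative, coeff_succ_X_mul, map_sum] at this
  simp only [coeff_C_mul] at this
  rw [this, mul_comm]

end Formal


/-! ### The BCH terms when `⁅x, e⁆ = α • e` and `y = c • e`. -/

section Affine

open PowerSeries

variable {K : Type*} [Field K] [CharZero K] {L : Type*} [LieRing L] [LieAlgebra K L]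
  {x e : L} {α : K}

omit [CharZero K] in
theorem ad_pow_eigenvector (h : ⁅x, e⁆ = α • e) (i : ℕ) :
    ((LieAlgebra.ad K L x) ^ i) e = α ^ i • e := by
  induction i with
  | zero => simp
  | succ i ih => rw [pow_succ', Module.End.mul_apply, ih, map_smul, LieAlgebra.ad_apply, h,
      smul_smul, pow_succ]

-- A single block survives only as `x` alone or with exactly one `y`, because `⁅x, x⁆ = 0` and `⁅y,
-- y⁆ = 0`.
omit [CharZero K] in
theorem nestedBracket_replicate (h : ⁅x, e⁆ = α • e) (c : K) {i j : ℕ} (hij : i + j ≠ 0) :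
    nestedBracket (List.replicate i x ++ List.replicate j (c • e)) =
      if j = 1 then (c * α ^ i) • e else if i = 1 ∧ j = 0 then x else 0 := by
  match j with
  | 0 =>
    obtain ⟨i, rfl⟩ := Nat.exists_eq_succ_of_ne_zero (by simpa using hij)
    rw [List.replicate_zero, List.append_nil, Nat.succ_eq_add_one, List.replicate_add,
      nestedBracket_replicate_append K _ (by simp)]
    cases i with
    | zero => simp [nestedBracket]
    | succ i => simp [nestedBracket, pow_succ]
  | 1 =>
    rw [nestedBracket_replicate_append K _ (by simp)]
    simp [nestedBracket, ad_pow_eigenvector h, smul_smul]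
  | j + 2 =>
    have : nestedBracket (List.replicate (j + 2) (c • e)) = 0 := by
      rw [List.replicate_add, nestedBracket_replicate_append K _ (by simp)]
      cases j <;> simp [nestedBracket, List.replicate_succ]
    rw [nestedBracket_replicate_append K _ (by simp), this]
    simp

omit [CharZero K] in
variable (K) in
theorem blockSum_succ_zero (x y : L) (k : ℕ) : blockSum K x y (k + 1) 0 = 0 := by
  rw [blockSum, Finset.sum_eq_zero]
  intro p hp
  obtain ⟨h1, h2⟩ := mem_blockIndices.1 hp
  rw [Finset.sum_eq_zero_iff] at h2
  have := h2 0 (Finset.mem_univ _)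
  exact absurd (by ext <;> simp <;> omega) (h1 0)

theorem blockSum_one_eq (h : ⁅x, e⁆ = α • e) (c : K) (n : ℕ) :
    blockSum K x (c • e) 1 n =
      coeff n (X : PowerSeries K) • x + coeff n (C c * X * rescale α (exp K)) • e := by
  cases n with
  | zero => simp [blockSum_succ_zero, mul_assoc]
  | succ n =>
    rw [blockSum_one _ _ _ n.succ_ne_zero, Finset.Nat.sum_antidiagonal_succ',
      Finset.sum_eq_single (n, 0)]
    · rw [nestedBracket_replicate h c (by simp), nestedBracket_replicate h c (by simp),
        mul_assoc, coeff_C_mul, coeff_succ_X_mul, coeff_rescale, coeff_exp, coeff_X]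
      congr 1
      · by_cases hn : n = 0 <;> simp [hn]
      · simp [smul_smul]
        congr 1
        ring
    -- Here `j` counts the letters `y` beyond the first.
    · rintro ⟨i, j⟩ hij hne
      have hj : j ≠ 0 := by
        rintro rfl
        simp at hij hne
        omega
      rw [nestedBracket_replicate h c (by simp)]
      simp [hj]
    · simp

theorem sum_antidiagonal_ad (h : ⁅x, e⁆ = α • e) (c d s : K) (m : ℕ) :
    (∑ ij ∈ antidiagonal m, if m = 0 then 0 else (1 / ((ij.1 ! : K) * (ij.2 ! : K))) •
        ((LieAlgebra.ad K L x) ^ ij.1) (((LieAlgebra.ad K L (c • e)) ^ ij.2) (d • x + s • e))) =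
      (coeff m (rescale α (exp K - 1)) * s -
        α * coeff m (C c * X * rescale α (exp K)) * d) • e := by
  cases m with
  | zero =>
    have h0 : coeff 0 (rescale α (exp K - 1)) = 0 := by
      simp [coeff_rescale, -map_sub]
      simp
    rw [h0]
    simp [mul_assoc]
  | succ m =>
    have hex : ⁅e, x⁆ = -(α • e) := by rw [← lie_skew, h]
    -- One `ad y` lands in the line of `e`, which a second one kills: only blocks with at most one
    -- `y` contribute.
    have hy : (LieAlgebra.ad K L (c • e)) (d • x + s • e) = (-(α * c * d)) • e := by
      simp [hex, smul_smul]
      congr 1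
      ring
    have hx : ((LieAlgebra.ad K L x) ^ (m + 1)) x = 0 := by simp [pow_succ]
    rw [Finset.Nat.sum_antidiagonal_succ', Finset.sum_eq_single (m, 0)]
    · rw [zero_add, pow_one, hy]
      simp only [Nat.add_eq_zero_iff, one_ne_zero, and_false, if_false,
        pow_zero, map_smul, map_add, hx, ad_pow_eigenvector h, Module.End.one_apply]
      rw [mul_assoc (C c), coeff_C_mul, coeff_succ_X_mul, coeff_rescale, coeff_rescale, map_sub,
        coeff_exp, coeff_exp, coeff_one]
      simp only [smul_zero, zero_add, smul_smul, ← add_smul]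
      congr 1
      simp
      ring
    · rintro ⟨i, j⟩ hij hne
      have hj : j ≠ 0 := by
        rintro rfl
        simp at hij hne
        omega
      obtain ⟨j, rfl⟩ := Nat.exists_eq_succ_of_ne_zero hj
      rw [if_neg (by simp), pow_succ, Module.End.mul_apply, hy, pow_succ, Module.End.mul_apply]
      simp
    · simp

theorem blockSum_succ_succ_eq (h : ⁅x, e⁆ = α • e) (c : K) (k : ℕ) {D S : PowerSeries K}
    (hS : ∀ l, blockSum K x (c • e) (k + 1) l = coeff l D • x + coeff l S • e) (n : ℕ) :
    blockSum K x (c • e) (k + 2) n = coeff n (rescale α (exp K - 1) * S -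
      C α * ((C c * X * rescale α (exp K)) * D)) • e := by
  rw [blockSum_succ_succ, map_sub, coeff_C_mul, coeff_mul, coeff_mul, Finset.mul_sum,
    ← Finset.sum_sub_distrib, Finset.sum_smul]
  refine Finset.sum_congr rfl fun ml _ => ?_
  simp only [hS]
  rw [sum_antidiagonal_ad h, mul_assoc α]

/-- Only one-block words have an `x`-component. The second block acts on it and yields the
correction -t in the factor exp t - 1 - t; each further block acts on a multiple of `e` and
contributes exp t - 1, evaluated at αt. -/
theorem blockSum_eq (h : ⁅x, e⁆ = α • e) (c : K) (k n : ℕ) :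
    blockSum K x (c • e) (k + 1) n = (if k = 0 then coeff n (X : PowerSeries K) else 0) • x +
      coeff n (C c * X * rescale α (blockSeries K k)) • e := by
  have hX : rescale α (X : PowerSeries K) = C α * X := by
    ext n
    by_cases hn : n = 1 <;> simp [coeff_X, hn]
  induction k generalizing n with
  | zero => simpa [blockSeries] using blockSum_one_eq h c n
  | succ k ih =>
    cases k with
    | zero =>
      rw [blockSum_succ_succ_eq h c 0 (D := X) (S := C c * X * rescale α (exp K))
        (by simpa [blockSeries] using ih)]
      rw [if_neg (by omega), zero_smul, zero_add]
      refine congrArg (fun f => coeff n f • e) ?_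
      simp only [blockSeries, map_mul, map_sub, map_pow, hX]
      ring
    | succ k =>
      rw [blockSum_succ_succ_eq h c (k + 1) (D := 0)
        (S := C c * X * rescale α (blockSeries K (k + 1))) (by simpa using ih)]
      rw [if_neg (by omega), zero_smul, zero_add]
      refine congrArg (fun f => coeff n f • e) ?_
      simp only [blockSeries, map_mul, map_sub, map_pow, hX]
      ring

theorem bchTerm_succ (h : ⁅x, e⁆ = α • e) (c : K) (n : ℕ) :
    bchTerm K (n + 1) x (c • e) =
      (if n = 0 then x else 0) + (c * (α ^ n * coeff n (bernoulli'PowerSeries K))) • e := by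
  have hn : (n : K) + 1 ≠ 0 := by exact_mod_cast n.succ_ne_zero
  have h1 : bchTerm K (n + 1) x (c • e) = (1 / ((n : K) + 1)) • ∑ k ∈ Finset.range (n + 1),
      ((-1 : K) ^ k / ((k : K) + 1)) • blockSum K x (c • e) (k + 1) (n + 1) := by
    rw [bchTerm, ← Finset.Ico_add_one_right_eq_Icc, Finset.sum_Ico_eq_sum_range]
    push_cast
    congr 1
    refine Finset.sum_congr rfl fun k _ => ?_
    rw [add_comm 1 k, add_comm 1 (k : K), pow_succ, pow_succ]
    simp [blockSum]
  rw [h1]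
  simp only [blockSum_eq h, smul_add, Finset.sum_add_distrib, smul_smul, mul_assoc (C c),
    coeff_C_mul, coeff_succ_X_mul, coeff_rescale]
  congr 1
  · rw [Finset.sum_eq_single 0 (fun k _ hk => by simp [hk]) (by simp)]
    by_cases hn0 : n = 0 <;> simp [hn0, coeff_X]
  · rw [← Finset.sum_smul, smul_smul]
    congr 1
    have := sum_coeff_blockSeries K n
    calc _ = 1 / ((n : K) + 1) * (c * α ^ n * ∑ k ∈ Finset.range (n + 1), (-1 : K) ^ k /
          ((k : K) + 1) * coeff n (blockSeries K k)) := by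
            rw [Finset.mul_sum (s := Finset.range (n + 1)) (a := c * α ^ n)]
            congr 1
            refine Finset.sum_congr rfl fun k _ => ?_
            ring
      _ = _ := by
            rw [this]
            field_simp

theorem bchPartialSum_eq (h : ⁅x, e⁆ = α • e) (c : K) (N : ℕ) :
    bchPartialSum K x (c • e) (N + 1) = x +
      (c * ∑ n ∈ Finset.range (N + 1), α ^ n * coeff n (bernoulli'PowerSeries K)) • e := by
  rw [bchPartialSum, ← Finset.Ico_add_one_right_eq_Icc, Finset.sum_Ico_eq_sum_range]
  simp only [add_comm 1, bchTerm_succ h, Finset.sum_add_distrib, Nat.add_sub_cancel]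
  rw [Finset.mul_sum, Finset.sum_smul]
  simp

end Affine


/-! ### Todd's function: Taylor series, radius of convergence, analyticity. -/

section Todd

open PowerSeries

/-- The Taylor coefficients of `todd` at `0`. -/
noncomputable def toddCoeff (n : ℕ) : ℂ := coeff n (bernoulli'PowerSeries ℂ)

theorem toddCoeff_eq (n : ℕ) : toddCoeff n = ((bernoulli' n / n ! : ℚ) : ℂ) := by
  simp [toddCoeff, bernoulli'PowerSeries]

theorem hasSum_norm_toddCoeff {k : ℕ} (hk : k ≠ 0) :
    HasSum (fun n : ℕ => 1 / (n : ℝ) ^ (2 * k))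
      (‖toddCoeff (2 * k)‖ * (2 * Real.pi) ^ (2 * k) / 2) := by
  have h := hasSum_zeta_nat hk
  have hnn := h.nonneg (fun n => by positivity)
  convert h using 1
  -- The zeta value is nonnegative, so absolute values remove the sign of the Bernoulli number.
  rw [← abs_of_nonneg hnn, toddCoeff_eq, bernoulli'_eq_bernoulli, Complex.norm_ratCast]
  have h2 : (2 : ℝ) ^ (2 * k) = 2 ^ (2 * k - 1) * 2 := by
    rw [← pow_succ]
    congr 1
    omega
  have hpi : |Real.pi| = Real.pi := abs_of_pos Real.pi_pos
  rw [mul_pow, h2]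
  push_cast
  simp only [abs_div, abs_mul, abs_pow, abs_neg, abs_one, one_pow, one_mul, hpi, Nat.abs_ofNat,
    Nat.abs_cast]
  ring

theorem two_le_norm_toddCoeff {k : ℕ} (hk : k ≠ 0) :
    2 ≤ ‖toddCoeff (2 * k)‖ * (2 * Real.pi) ^ (2 * k) := by
  have h := hasSum_norm_toddCoeff hk
  have := h.summable.le_tsum 1 (fun n _ => by positivity)
  rw [h.tsum_eq] at this
  simp at this
  linarith

/-- For even indices from 2 on the quantity is 2ζ(2k) ≤ 2ζ(2); odd Bernoulli numbers vanish beyond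
index 1, and indices 0 and 1 are added by hand. -/
theorem exists_norm_toddCoeff_le : ∃ M : ℝ, ∀ n, ‖toddCoeff n‖ * (2 * Real.pi) ^ n ≤ M := by
  have h1 := hasSum_norm_toddCoeff one_ne_zero
  set M := ‖toddCoeff (2 * 1)‖ * (2 * Real.pi) ^ (2 * 1) with hM
  have hM0 : 0 ≤ M := by positivity
  refine ⟨M + ‖toddCoeff 0‖ + ‖toddCoeff 1‖ * (2 * Real.pi), fun n => ?_⟩
  have hp := Real.pi_pos
  have h01 : 0 ≤ ‖toddCoeff 1‖ * (2 * Real.pi) := by positivity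
  rcases Nat.even_or_odd' n with ⟨k, rfl | rfl⟩
  · rcases eq_or_ne k 0 with rfl | hk
    · simp only [mul_zero, pow_zero, mul_one]
      linarith [norm_nonneg (toddCoeff 0)]
    · have h2 := hasSum_norm_toddCoeff hk
      have := hasSum_le (fun n => by
        rcases Nat.eq_zero_or_pos n with rfl | hn
        · simp [hk]
        · have : (1 : ℝ) ≤ n := by exact_mod_cast hn
          exact one_div_le_one_div_of_le (by positivity)
            (pow_le_pow_right₀ this (by omega : 2 * 1 ≤ 2 * k))) h2 h1
      have : 0 ≤ ‖toddCoeff 0‖ + ‖toddCoeff 1‖ * (2 * Real.pi) := by positivity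
      linarith
  · rcases eq_or_ne k 0 with rfl | hk
    · simp only [mul_zero, zero_add, pow_one]
      linarith [norm_nonneg (toddCoeff 0)]
    · rw [toddCoeff_eq, bernoulli'_eq_zero_of_odd (by simp) (by omega)]
      simp
      positivity

theorem summable_norm_toddCoeff {a : ℂ} (ha : ‖a‖ < 2 * Real.pi) :
    Summable fun n => ‖a ^ n * toddCoeff n‖ := by
  obtain ⟨M, hM⟩ := exists_norm_toddCoeff_le
  have hp := Real.pi_pos
  have hr : ‖a‖ / (2 * Real.pi) < 1 := (div_lt_one (by positivity)).2 ha
  refine Summable.of_nonneg_of_le (fun _ => norm_nonneg _) (fun n => ?_)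
    ((summable_geometric_of_lt_one (by positivity) hr).mul_left M)
  have := mul_le_mul_of_nonneg_right (hM n)
    (by positivity : 0 ≤ (‖a‖ / (2 * Real.pi)) ^ n)
  refine le_trans (le_of_eq ?_) this
  rw [norm_mul, norm_pow, div_pow]
  field_simp

theorem twoPiI_eq : twoPiI = 2 * (Real.pi : ℂ) * Complex.I := rfl

theorem norm_twoPiI : ‖twoPiI‖ = 2 * Real.pi := by
  simp [twoPiI, abs_of_pos Real.pi_pos]

theorem twoPiI_ne_zero : twoPiI ≠ 0 := by
  rw [← norm_pos_iff, norm_twoPiI]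
  exact Real.two_pi_pos

theorem exp_twoPiI : Complex.exp twoPiI = 1 := Complex.exp_two_pi_mul_I

theorem exp_neg_ne_one {a : ℂ} (ha : ∀ k : ℤ, k ≠ 0 → a ≠ (k : ℂ) * twoPiI) (h0 : a ≠ 0) :
    1 - Complex.exp (-a) ≠ 0 := by
  rw [sub_ne_zero]
  intro h
  obtain ⟨n, hn⟩ := Complex.exp_eq_one_iff.1 h.symm
  refine ha (-n) ?_ ?_
  · rintro h
    rw [neg_eq_zero] at h
    subst h
    simp at hn
    exact h0 hn
  · rw [twoPiI_eq]
    push_cast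
    linear_combination -hn

theorem ne_intCast_mul_twoPiI {a : ℂ} (ha : ‖a‖ < 2 * Real.pi) (k : ℤ) (hk : k ≠ 0) :
    a ≠ (k : ℂ) * twoPiI := by
  rintro rfl
  rw [norm_mul, norm_twoPiI, Complex.norm_intCast] at ha
  have : (1 : ℝ) ≤ |(k : ℝ)| := by exact_mod_cast Int.one_le_abs hk
  nlinarith [Real.pi_pos]

/-- The formal identity ψ(t)(exp t - 1) = t exp t passes to values through the Cauchy product of
absolutely convergent series. -/
theorem hasSum_todd {a : ℂ} (ha : ‖a‖ < 2 * Real.pi) :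
    HasSum (fun n => a ^ n * toddCoeff n) (todd a) := by
  have hs := summable_norm_toddCoeff ha
  rcases eq_or_ne a 0 with rfl | h0
  · convert hasSum_single (f := fun n => (0 : ℂ) ^ n * toddCoeff n) 0 (fun n hn => by simp [hn])
    simp [todd, toddCoeff_eq]
  have hne := exp_neg_ne_one (ne_intCast_mul_twoPiI ha) h0
  have hE : HasSum (fun n => a ^ n / (n ! : ℂ)) (Complex.exp a) := by
    rw [Complex.exp_eq_exp_ℂ]
    exact NormedSpace.expSeries_div_hasSum_exp a
  have hE' : HasSum (fun n => a ^ n * coeff n (exp ℂ - 1)) (Complex.exp a - 1) := by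
    have h1 : HasSum (fun n => a ^ n * coeff n (1 : PowerSeries ℂ)) 1 := by
      convert hasSum_single (f := fun n => a ^ n * coeff n (1 : PowerSeries ℂ)) 0
        (fun n hn => by simp [coeff_one, hn])
      simp
    refine (hE.sub h1).congr_fun fun n => ?_
    rw [map_sub, mul_sub, coeff_exp]
    simp [div_eq_mul_inv]
  have hsE : Summable fun n => ‖a ^ n * coeff n (exp ℂ - 1)‖ := hE'.summable.norm
  have hmul := tsum_mul_tsum_eq_tsum_sum_antidiagonal_of_summable_norm hs hsE
  have hterm : ∀ n, ∑ kl ∈ antidiagonal n, a ^ kl.1 * toddCoeff kl.1 *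
      (a ^ kl.2 * coeff kl.2 (exp ℂ - 1)) = a ^ n * coeff n (X * exp ℂ) := by
    intro n
    rw [← bernoulli'PowerSeries_mul_exp_sub_one, coeff_mul, Finset.mul_sum]
    refine Finset.sum_congr rfl fun kl hkl => ?_
    rw [← (Finset.HasAntidiagonal.mem_antidiagonal.1 hkl), pow_add, toddCoeff]
    ring
  have hR : HasSum (fun n => a ^ n * coeff n (X * exp ℂ)) (a * Complex.exp a) := by
    rw [← hasSum_nat_add_iff' 1]
    simp only [coeff_succ_X_mul, Finset.sum_range_one, coeff_zero_X_mul, mul_zero, sub_zero]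
    refine (hE.mul_left a).congr_fun fun n => ?_
    simp [coeff_exp]
    ring
  rw [funext hterm, hR.tsum_eq, hE'.tsum_eq] at hmul
  have : ∑' n, a ^ n * toddCoeff n = todd a := by
    rw [todd, if_neg h0, eq_div_iff hne]
    have h2 : Complex.exp a * Complex.exp (-a) = 1 := by rw [← Complex.exp_add]; simp
    linear_combination Complex.exp (-a) * hmul + (a - ∑' n, a ^ n * toddCoeff n) * h2
  exact this ▸ hs.of_norm.hasSum

theorem not_tendsto_toddCoeff {a : ℂ} (ha : 2 * Real.pi ≤ ‖a‖) :
    ¬ Tendsto (fun n => a ^ n * toddCoeff n) atTop (𝓝 0) := by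
  intro h
  -- Along positive even indices the terms have norm at least 2.
  have h2 : Tendsto (fun k : ℕ => 2 * (k + 1)) atTop atTop :=
    tendsto_atTop_mono (fun k => by simp only [id]; omega) tendsto_id
  have h3 := (h.comp h2).norm
  rw [norm_zero] at h3
  have := ge_of_tendsto' h3 (b := 2) (fun k => by
    have := two_le_norm_toddCoeff k.succ_ne_zero
    refine this.trans ?_
    simp only [Function.comp_apply, norm_mul, norm_pow, Nat.succ_eq_add_one]
    rw [mul_comm]
    have hp := Real.pi_pos
    gcongr)
  norm_num at this

theorem one_sub_exp_neg_differentiable :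
    Differentiable ℂ fun z : ℂ => 1 - Complex.exp (-z) := by fun_prop

theorem todd_eq_inv_dslope :
    todd = fun z => (dslope (fun z : ℂ => 1 - Complex.exp (-z)) 0 z)⁻¹ := by
  funext z
  rcases eq_or_ne z 0 with rfl | h
  · have : HasDerivAt (fun z : ℂ => 1 - Complex.exp (-z)) 1 0 := by
      have := ((hasDerivAt_neg (0 : ℂ)).cexp).const_sub 1
      simpa using this
    rw [dslope_same, this.deriv]
    simp [todd]
  · rw [dslope_of_ne _ h, slope_def_field]
    simp [todd, h]

theorem analyticAt_todd {a : ℂ} (ha : ∀ k : ℤ, k ≠ 0 → a ≠ (k : ℂ) * twoPiI) :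
    AnalyticAt ℂ todd a := by
  rw [todd_eq_inv_dslope]
  have hd : Differentiable ℂ (dslope (fun z : ℂ => 1 - Complex.exp (-z)) 0) := by
    rw [← differentiableOn_univ, Complex.differentiableOn_dslope univ_mem]
    exact one_sub_exp_neg_differentiable.differentiableOn
  refine (hd.analyticAt a).inv ?_
  -- If the slope vanished, the convention `0⁻¹ = 0` would force `todd a = 0`, which is false.
  have ht := congrFun todd_eq_inv_dslope a
  intro h
  rw [h, inv_zero] at ht
  rcases eq_or_ne a 0 with rfl | h0
  · simp [todd] at ht
  · rw [todd, if_neg h0] at ht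
    exact div_ne_zero h0 (exp_neg_ne_one ha h0) ht

end Todd


/-! ### The matrix example: convergence set, prolongation and singularity. -/

section Example

theorem matY_eq (β : ℂ) : matY β = (β * (β - twoPiI)) • !![0, 1; 0, 0] := by
  simp [matY]

theorem lie_matX (α : ℂ) :
    ⁅matX α, (!![0, 1; 0, 0] : Matrix (Fin 2) (Fin 2) ℂ)⁆ = α • !![0, 1; 0, 0] := by
  rw [Ring.lie_def]
  ext i j
  fin_cases i <;> fin_cases j <;> simp [matX]
  ring

theorem bchPartialSum_matX_matY (α β : ℂ) (N : ℕ) :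
    bchPartialSum ℂ (matX α) (matY β) (N + 1) = !![-α, (β * (β - twoPiI)) *
      ∑ n ∈ Finset.range (N + 1), α ^ n * toddCoeff n; 0, -(2 * α)] := by
  rw [matY_eq, bchPartialSum_eq (lie_matX α)]
  ext i j
  fin_cases i <;> fin_cases j <;> simp [matX, toddCoeff]

theorem continuous_upperTriangular (a d : ℂ) :
    Continuous fun z : ℂ => (!![a, z; 0, d] : Matrix (Fin 2) (Fin 2) ℂ) := by
  refine continuous_matrix fun i j => ?_
  fin_cases i <;> fin_cases j <;> simp <;> fun_prop

theorem bchHasSum_iff (α β z : ℂ) :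
    BCHHasSum ℂ (matX α) (matY β) !![-α, z; 0, -(2 * α)] ↔
      Tendsto (fun N => (β * (β - twoPiI)) * ∑ n ∈ Finset.range N, α ^ n * toddCoeff n)
        atTop (𝓝 z) := by
  -- The shift skips the empty partial sum, which is 0 and lacks the summand `matX α`.
  rw [BCHHasSum, ← tendsto_add_atTop_iff_nat 1, ← tendsto_add_atTop_iff_nat (f := fun N => _ * _) 1]
  simp only [bchPartialSum_matX_matY]
  refine ⟨fun h => ?_, fun h => (continuous_upperTriangular _ _).tendsto z |>.comp h⟩
  exact ((continuous_id.matrix_elem 0 1).tendsto _).comp h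

theorem bchHasSum_of_norm_lt {α : ℂ} (hα : ‖α‖ < 2 * Real.pi) (β : ℂ) :
    BCHHasSum ℂ (matX α) (matY β) !![-α, todd α * (β * (β - twoPiI)); 0, -(2 * α)] := by
  rw [bchHasSum_iff, mul_comm (todd α)]
  exact (hasSum_todd hα).tendsto_sum_nat.const_mul _

theorem mul_sub_twoPiI_eq_zero {β : ℂ} :
    β * (β - twoPiI) = 0 ↔ β ∈ ({0, twoPiI} : Set ℂ) := by
  simp [sub_eq_zero]

theorem bchHasSum_of_mem {β : ℂ} (hβ : β ∈ ({0, twoPiI} : Set ℂ)) (α : ℂ) :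
    BCHHasSum ℂ (matX α) (matY β) !![-α, 0; 0, -(2 * α)] := by
  rw [bchHasSum_iff, mul_sub_twoPiI_eq_zero.2 hβ]
  simp

theorem mem_setD {q : ℂ × ℂ} :
    q ∈ setD ↔ ‖q.1‖ < 2 * Real.pi ∨ q.2 ∈ ({0, twoPiI} : Set ℂ) := by
  refine ⟨fun h => h.elim (fun h => .inl h.1) (fun h => .inr h.2), fun h => ?_⟩
  by_cases hq : q.2 ∈ ({0, twoPiI} : Set ℂ)
  · exact .inr ⟨trivial, hq⟩
  · exact .inl ⟨h.resolve_right hq, hq⟩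

theorem norm_lt_of_bchConverges {α β : ℂ} (h : BCHConverges ℂ (matX α) (matY β))
    (hβ : β ∉ ({0, twoPiI} : Set ℂ)) : ‖α‖ < 2 * Real.pi := by
  by_contra! hα
  refine not_tendsto_toddCoeff hα ?_
  obtain ⟨A, hA⟩ := h
  have hc : β * (β - twoPiI) ≠ 0 := mt mul_sub_twoPiI_eq_zero.1 hβ
  rw [BCHHasSum, ← tendsto_add_atTop_iff_nat 1] at hA
  simp only [bchPartialSum_matX_matY] at hA
  have h1 := (((continuous_id.matrix_elem 0 1).tendsto _).comp hA).const_mul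
    (β * (β - twoPiI))⁻¹
  have h2 : Tendsto (fun N => ∑ n ∈ Finset.range (N + 1), α ^ n * toddCoeff n) atTop
      (𝓝 ((β * (β - twoPiI))⁻¹ * A 0 1)) := by
    refine h1.congr fun N => ?_
    exact inv_mul_cancel_left₀ hc _
  -- Differences of consecutive partial sums recover the terms.
  have h3 := (h2.comp (tendsto_add_atTop_nat 1)).sub h2
  rw [sub_self] at h3
  rw [← tendsto_add_atTop_iff_nat 1]
  refine h3.congr fun N => ?_
  simp [Finset.sum_range_succ]

theorem bchConverges_iff (α β : ℂ) :
    BCHConverges ℂ (matX α) (matY β) ↔ (α, β) ∈ setD := by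
  rw [mem_setD]
  refine ⟨fun h => or_iff_not_imp_right.2 (norm_lt_of_bchConverges h), ?_⟩
  rintro (h | h)
  · exact ⟨_, bchHasSum_of_norm_lt h β⟩
  · exact ⟨_, bchHasSum_of_mem h α⟩

theorem interior_setD : interior setD = {q : ℂ × ℂ | ‖q.1‖ < 2 * Real.pi} := by
  refine subset_antisymm (fun q hq => ?_) (interior_maximal (fun q hq => mem_setD.2 (Or.inl hq))
    (isOpen_lt (by fun_prop) continuous_const))
  by_contra hn
  have h1 : ContinuousAt (fun β : ℂ => (q.1, β)) q.2 := by fun_prop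
  have h2 : {β : ℂ | (q.1, β) ∈ setD} ∈ 𝓝 q.2 := h1 (mem_interior_iff_mem_nhds.1 hq)
  -- Over a fixed α with |α| ≥ 2π the slice of `setD` has only two points, so it contains no
  -- neighbourhood.
  refine infinite_of_mem_nhds q.2 h2 (Set.Finite.subset (Set.toFinite {0, twoPiI}) fun β hβ => ?_)
  exact (mem_setD.1 hβ).resolve_left hn

theorem matZ_eq_matP {q : ℂ × ℂ} (hq : ‖q.1‖ < 2 * Real.pi) : matZ q = matP q :=
  (bchHasSum_of_norm_lt hq q.2).limUnder_eq

theorem isOpen_Omega : IsOpen Omega := by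
  -- The disc is needed for α = 0, which is allowed although its exponential is 1.
  have : Omega = {q | ‖q.1‖ < 2 * Real.pi} ∪ {q | Complex.exp q.1 ≠ 1} := by
    ext q
    simp only [Omega, Set.mem_ofPred_eq, Set.mem_union]
    constructor
    · intro h
      by_contra! hn
      obtain ⟨n, hn1⟩ := Complex.exp_eq_one_iff.1 hn.2
      rcases eq_or_ne n 0 with rfl | h0
      · have := hn.1
        simp [hn1] at this
        exact absurd this (not_le.2 Real.two_pi_pos)
      · exact h n h0 hn1
    · rintro (h | h) k hk
      · exact ne_intCast_mul_twoPiI h k hk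
      · exact fun h' => h (Complex.exp_eq_one_iff.2 ⟨k, h'⟩)
  rw [this]
  exact (isOpen_lt (by fun_prop) continuous_const).union
    (isOpen_ne_fun (by fun_prop) continuous_const)

theorem analyticOnNhd_matP : AnalyticOnNhd ℂ matP Omega := by
  intro q hq
  have h : matP = fun q : ℂ × ℂ => (-q.1) • (!![1, 0; 0, 0] : Matrix (Fin 2) (Fin 2) ℂ) +
      (todd q.1 * (q.2 * (q.2 - twoPiI))) • !![0, 1; 0, 0] + (-(2 * q.1)) • !![0, 0; 0, 1] := by
    funext q
    simp [matP]
  have ht : AnalyticAt ℂ (fun q : ℂ × ℂ => todd q.1) q := (analyticAt_todd hq).comp analyticAt_fst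
  rw [h]
  exact ((analyticAt_fst.neg.smul analyticAt_const).add
    ((ht.mul (analyticAt_snd.mul (analyticAt_snd.sub analyticAt_const))).smul
      analyticAt_const)).add ((analyticAt_const.mul analyticAt_fst).neg.smul analyticAt_const)

theorem tendsto_nhdsWithin_Omega {g : ℂ → ℂ} (hg : Continuous g) (hg0 : g 0 = twoPiI) :
    Tendsto (fun s : ℂ => (twoPiI + s, g s)) (𝓝[≠] 0) (𝓝[Omega] (twoPiI, twoPiI)) := by
  refine tendsto_nhdsWithin_iff.2 ⟨?_, ?_⟩
  · have : Continuous fun s : ℂ => (twoPiI + s, g s) := by fun_prop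
    convert (this.tendsto 0).mono_left nhdsWithin_le_nhds using 2
    simp [hg0]
  · have : ∀ᶠ s : ℂ in 𝓝 0, ‖s‖ < 2 * Real.pi :=
      continuous_norm.continuousAt.eventually_lt continuousAt_const (by simp [Real.pi_pos])
    filter_upwards [self_mem_nhdsWithin, this.filter_mono nhdsWithin_le_nhds] with s hs hs2 k _ hk
    dsimp only at hk
    rcases eq_or_ne k 1 with rfl | hk1
    · exact hs (by simpa using hk)
    · refine ne_intCast_mul_twoPiI hs2 (k - 1) (sub_ne_zero.2 hk1) ?_
      push_cast
      linear_combination hk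

/-- Along β = 2πi the corner entry is 0. Along β = α = 2πi + s, periodicity of exp makes it (2πi +
s)² ψ(s), which tends to (2πi)² ≠ 0. -/
theorem not_exists_tendsto_matP :
    ¬ ∃ A : Matrix (Fin 2) (Fin 2) ℂ, Tendsto matP (𝓝[Omega] (twoPiI, twoPiI)) (𝓝 A) := by
  rintro ⟨A, hA⟩
  have h1 : Tendsto (fun q : ℂ × ℂ => todd q.1 * (q.2 * (q.2 - twoPiI)))
      (𝓝[Omega] (twoPiI, twoPiI)) (𝓝 (A 0 1)) :=
    ((continuous_id.matrix_elem 0 1).tendsto _).comp hA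
  have h2 := h1.comp (tendsto_nhdsWithin_Omega (g := fun _ => twoPiI) continuous_const rfl)
  have h3 := h1.comp (tendsto_nhdsWithin_Omega (g := fun s => twoPiI + s) (by fun_prop) (by simp))
  have h4 : A 0 1 = 0 := by
    refine tendsto_nhds_unique h2 ?_
    simp [Function.comp_def]
  have h5 : Tendsto (fun s => (twoPiI + s) ^ 2 * todd s) (𝓝[≠] 0) (𝓝 (twoPiI ^ 2)) := by
    have hc : ContinuousAt (fun s => (twoPiI + s) ^ 2 * todd s) 0 := by
      have : ContinuousAt todd 0 :=
        (analyticAt_todd (ne_intCast_mul_twoPiI (by simp [Real.pi_pos]))).continuousAt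
      exact ContinuousAt.mul (by fun_prop) this
    have h := hc.tendsto.mono_left (nhdsWithin_le_nhds (s := {0}ᶜ))
    simpa [todd] using h
  have h6 : A 0 1 = twoPiI ^ 2 := by
    refine tendsto_nhds_unique h3 (h5.congr' ?_)
    have : ∀ᶠ s : ℂ in 𝓝 0, twoPiI + s ≠ 0 :=
      ContinuousAt.eventually_ne (by fun_prop) (by simp [twoPiI_ne_zero])
    filter_upwards [self_mem_nhdsWithin, this.filter_mono nhdsWithin_le_nhds] with s hs hs2
    have hexp : Complex.exp (-(twoPiI + s)) = Complex.exp (-s) := by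
      rw [neg_add, Complex.exp_add, Complex.exp_neg twoPiI, exp_twoPiI, inv_one, one_mul]
    have hs' : s ≠ 0 := hs
    simp only [Function.comp_apply, todd, if_neg hs', if_neg hs2, hexp]
    ring
  exact pow_ne_zero 2 twoPiI_ne_zero (h6.symm.trans h4)

theorem not_exists_analytic_prolongation :
    ¬ ∃ (U : Set (ℂ × ℂ)) (Q : ℂ × ℂ → Matrix (Fin 2) (Fin 2) ℂ),
      IsOpen U ∧ (twoPiI, twoPiI) ∈ U ∧ AnalyticOnNhd ℂ Q U ∧ Set.EqOn Q matP (U ∩ Omega) := by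
  rintro ⟨U, Q, hU, hmem, hQ, hEq⟩
  refine not_exists_tendsto_matP ⟨Q (twoPiI, twoPiI), ?_⟩
  refine ((hQ _ hmem).continuousAt.tendsto.mono_left nhdsWithin_le_nhds).congr' ?_
  filter_upwards [self_mem_nhdsWithin, mem_nhdsWithin_of_mem_nhds (hU.mem_nhds hmem)] with q h1 h2
  exact hEq ⟨h2, h1⟩

end Example

end BCH

theorem mainTheorem4 :
    -- the BCH series of `X(α), Y(β)` converges exactly on `D`
    (∀ α β : ℂ, BCH.BCHConverges ℂ (BCH.matX α) (BCH.matY β) ↔ (α, β) ∈ BCH.setD) ∧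
    -- its sum on `D`
    (∀ α β : ℂ, ‖α‖ < 2 * Real.pi → β ∉ ({0, BCH.twoPiI} : Set ℂ) →
      BCH.BCHHasSum ℂ (BCH.matX α) (BCH.matY β)
        !![-α, BCH.todd α * (β * (β - BCH.twoPiI)); 0, -(2 * α)]) ∧
    (∀ α β : ℂ, β ∈ ({0, BCH.twoPiI} : Set ℂ) →
      BCH.BCHHasSum ℂ (BCH.matX α) (BCH.matY β) !![-α, 0; 0, -(2 * α)]) ∧
    -- the interior of `D`, and analyticity of the sum there
    interior BCH.setD = {q : ℂ × ℂ | ‖q.1‖ < 2 * Real.pi} ∧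
    AnalyticOnNhd ℂ BCH.matZ (interior BCH.setD) ∧
    -- analytic prolongation by `P` to `Ω`
    IsOpen BCH.Omega ∧ interior BCH.setD ⊆ BCH.Omega ∧
    AnalyticOnNhd ℂ BCH.matP BCH.Omega ∧
    Set.EqOn BCH.matZ BCH.matP (interior BCH.setD) ∧
    -- `P` is singular at `(2πi, 2πi)`: it has no limit there, and agrees near that point with no
    -- function analytic in a neighbourhood of it
    (¬ ∃ A : Matrix (Fin 2) (Fin 2) ℂ,
      Tendsto BCH.matP (𝓝[BCH.Omega] (BCH.twoPiI, BCH.twoPiI)) (𝓝 A)) ∧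
    (¬ ∃ (U : Set (ℂ × ℂ)) (Q : ℂ × ℂ → Matrix (Fin 2) (Fin 2) ℂ),
      IsOpen U ∧ (BCH.twoPiI, BCH.twoPiI) ∈ U ∧ AnalyticOnNhd ℂ Q U ∧
        Set.EqOn Q BCH.matP (U ∩ BCH.Omega)) ∧
    -- nevertheless the BCH series converges at `(2πi, 2πi)`, to `X(2πi)`
    (BCH.twoPiI, BCH.twoPiI) ∈ BCH.setD ∧
    BCH.BCHHasSum ℂ (BCH.matX BCH.twoPiI) (BCH.matY BCH.twoPiI) (BCH.matX BCH.twoPiI) := by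
  have hmem : BCH.twoPiI ∈ ({0, BCH.twoPiI} : Set ℂ) := Or.inr rfl
  have hZ : Set.EqOn BCH.matZ BCH.matP (interior BCH.setD) := by
    rw [BCH.interior_setD]
    exact fun q hq => BCH.matZ_eq_matP hq
  have hΩ : interior BCH.setD ⊆ BCH.Omega := by
    rw [BCH.interior_setD]
    exact fun q hq k hk => BCH.ne_intCast_mul_twoPiI hq k hk
  exact ⟨BCH.bchConverges_iff, fun _ β hα _ => BCH.bchHasSum_of_norm_lt hα β,
    fun α _ hβ => BCH.bchHasSum_of_mem hβ α, BCH.interior_setD,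
    (BCH.analyticOnNhd_matP.mono hΩ).congr isOpen_interior hZ.symm, BCH.isOpen_Omega, hΩ,
    BCH.analyticOnNhd_matP, hZ, BCH.not_exists_tendsto_matP, BCH.not_exists_analytic_prolongation,
    BCH.mem_setD.2 (Or.inr hmem), BCH.bchHasSum_of_mem hmem BCH.twoPiI⟩
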